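/- Let $F$ be a field of characteristic $0$ containing a primitive 7th root of unity $\zeta_7$. Let $\phi,\psi\in F[w]$ be polynomials with $\deg\phi\le 7$ and $\deg\psi\le 3$ such that $$f(x,y)=x^{14}+y^{14}+\phi(xy)+(x^7-y^7)\,\psi(xy)$$ is irreducible in $F[x,y]$, and such that the coefficient of $w^7$ in $\phi$ is not $2$. Let $X$ be the smooth projective curve over $F$ with function field $K=F(x,y)$, $f(x,y)=0$; let $C_7=\langle s\rangle$ be the group of order $7$ acting on $X$ by $s(x)=\zeta_7x$, $s(y)=\zeta_7^{-1}y$; and let $X/C_7$ be the quotient curve, whose function field is the fixed field $K^{C_7}$. Suppose that $$\psi(w)^2-4\bigl(\phi(w)+2w^7\bigr)=(w-a)\,C(w)^2$$ for some $a\in F$, $a\ne 0$, and some polynomial $C\in F[w]$ of degree at most $3$, and put $$\tau(m)=\frac{-\psi(m^2+a)+m\,C(m^2+a)}{2}\in F[m].$$ Then $X/C_7$ has genus $2$ if and only if there are polynomials $q,s\in F[m]$ with $\deg q=4$, $\deg s=6$ and $s$ without multiple roots such that $$\tau(m)^2+4(m^2+a)^7=q(m)^2\,s(m).$$ -/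

import Mathlib

/-! ### The genus of a function field -/

/-- The space of everywhere regular differentials of a function field `L` over `k`: those
`ω ∈ Ω[L⁄k]` which, for every valuation ring `O` of `L` containing `k`, lie in the image of
`Ω[O⁄k]`, i.e. are finite sums `∑ bᵢ dzᵢ` with `bᵢ, zᵢ ∈ O`.
(The improper valuation ring `O = L` imposes no condition; the others are the local rings of the
closed points of the smooth projective model of `L`.) -/
noncomputable def regularDifferentials (k L : Type*) [Field k] [Field L] [Algebra k L] :
    Submodule k (Ω[L⁄k]) where
  carrier := {ω | ∀ O : ValuationSubring L, (∀ c : k, algebraMap k L c ∈ O) →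
    ω ∈ Submodule.span O (KaehlerDifferential.D k L '' (O : Set L))}
  zero_mem' := fun _ _ => Submodule.zero_mem _
  add_mem' := fun h₁ h₂ O hO => Submodule.add_mem _ (h₁ O hO) (h₂ O hO)
  smul_mem' := fun c ω h O hO => by
    have h1 := Submodule.smul_mem _ (⟨algebraMap k L c, hO c⟩ : O) (h O hO)
    have h2 : (⟨algebraMap k L c, hO c⟩ : O) • ω = c • ω := algebraMap_smul L c ω
    rwa [h2] at h1

/-- The genus of (the smooth projective curve over `k` with) the function field `L`, where `k` has
characteristic zero: the dimension over `k` of the space of everywhere regular differentials. -/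
noncomputable def functionFieldGenus (k L : Type*) [Field k] [Field L] [Algebra k L] : ℕ :=
  Module.finrank k (regularDifferentials k L)

/-! ### The plane curve and its function field -/

section Curve

variable {F : Type*} [Field F]

/-- The polynomial `f(x, y) = x ^ 14 + y ^ 14 + φ(xy) + (x ^ 7 - y ^ 7) ψ(xy)`. -/
noncomputable def curvePoly (φ ψ : Polynomial F) : MvPolynomial (Fin 2) F :=
  MvPolynomial.X 0 ^ 14 + MvPolynomial.X 1 ^ 14
    + Polynomial.aeval (MvPolynomial.X 0 * MvPolynomial.X 1 : MvPolynomial (Fin 2) F) φ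
    + (MvPolynomial.X 0 ^ 7 - MvPolynomial.X 1 ^ 7)
      * Polynomial.aeval (MvPolynomial.X 0 * MvPolynomial.X 1 : MvPolynomial (Fin 2) F) ψ

/-- The coordinate ring `F[x, y] / (f)`. -/
abbrev curveRing (φ ψ : Polynomial F) : Type _ :=
  MvPolynomial (Fin 2) F ⧸ Ideal.span {curvePoly φ ψ}

instance curveRing_isDomain (φ ψ : Polynomial F) [hf : Fact (Irreducible (curvePoly φ ψ))] :
    IsDomain (curveRing φ ψ) := by
  have : (Ideal.span {curvePoly φ ψ}).IsPrime :=
    (Ideal.span_singleton_prime hf.out.ne_zero).2 hf.out.prime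
  exact Ideal.Quotient.isDomain _

/-- The function field `K = F(x, y)`, `f(x, y) = 0`, of the curve `X`. -/
abbrev curveField (φ ψ : Polynomial F) : Type _ := FractionRing (curveRing φ ψ)

/-- The linear substitution `x ↦ α x`, `y ↦ β y` of `F[x, y]`. -/
noncomputable def scaleHom (α β : F) : MvPolynomial (Fin 2) F →ₐ[F] MvPolynomial (Fin 2) F :=
  MvPolynomial.aeval ![MvPolynomial.C α * MvPolynomial.X 0, MvPolynomial.C β * MvPolynomial.X 1]

theorem scaleHom_comp {α β γ δ : F} (h₀ : α * γ = 1) (h₁ : β * δ = 1) :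
    (scaleHom α β).comp (scaleHom γ δ) = AlgHom.id F _ := by
  ext i : 1
  have e₀ : (MvPolynomial.C γ * (MvPolynomial.C α * MvPolynomial.X 0) : MvPolynomial (Fin 2) F)
      = MvPolynomial.X 0 := by
    rw [← mul_assoc, ← MvPolynomial.C_mul, mul_comm γ, h₀, MvPolynomial.C_1, one_mul]
  have e₁ : (MvPolynomial.C δ * (MvPolynomial.C β * MvPolynomial.X 1) : MvPolynomial (Fin 2) F)
      = MvPolynomial.X 1 := by
    rw [← mul_assoc, ← MvPolynomial.C_mul, mul_comm δ, h₁, MvPolynomial.C_1, one_mul]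
  fin_cases i
  · simpa [scaleHom] using e₀
  · simpa [scaleHom] using e₁

/-- The automorphism `s : x ↦ ζ x, y ↦ ζ⁻¹ y` of `F[x, y]`, for a primitive 7th root of unity `ζ`. -/
noncomputable def rotationPoly {ζ : F} (hζ : IsPrimitiveRoot ζ 7) :
    MvPolynomial (Fin 2) F ≃ₐ[F] MvPolynomial (Fin 2) F :=
  AlgEquiv.ofAlgHom (scaleHom ζ ζ⁻¹) (scaleHom ζ⁻¹ ζ)
    (scaleHom_comp (mul_inv_cancel₀ (hζ.ne_zero (by norm_num)))
      (inv_mul_cancel₀ (hζ.ne_zero (by norm_num))))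
    (scaleHom_comp (inv_mul_cancel₀ (hζ.ne_zero (by norm_num)))
      (mul_inv_cancel₀ (hζ.ne_zero (by norm_num))))

theorem rotationPoly_curvePoly {ζ : F} (hζ : IsPrimitiveRoot ζ 7) (φ ψ : Polynomial F) :
    rotationPoly hζ (curvePoly φ ψ) = curvePoly φ ψ := by
  have hx : rotationPoly hζ (MvPolynomial.X 0) = MvPolynomial.C ζ * MvPolynomial.X 0 := by
    simp [rotationPoly, scaleHom]
  have hy : rotationPoly hζ (MvPolynomial.X 1) = MvPolynomial.C ζ⁻¹ * MvPolynomial.X 1 := by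
    simp [rotationPoly, scaleHom]
  have h0 : ζ ≠ 0 := hζ.ne_zero (by norm_num)
  have hw : (MvPolynomial.C ζ * MvPolynomial.X 0 * (MvPolynomial.C ζ⁻¹ * MvPolynomial.X 1) :
      MvPolynomial (Fin 2) F) = MvPolynomial.X 0 * MvPolynomial.X 1 := by
    rw [mul_mul_mul_comm, ← MvPolynomial.C_mul, mul_inv_cancel₀ h0, MvPolynomial.C_1, one_mul]
  have h7 : ζ ^ 7 = 1 := hζ.pow_eq_one
  have h14 : ζ ^ 14 = 1 := by rw [show 14 = 7 * 2 from rfl, pow_mul, h7, one_pow]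
  have hp (p : Polynomial F) : rotationPoly hζ
      (Polynomial.aeval (MvPolynomial.X 0 * MvPolynomial.X 1 : MvPolynomial (Fin 2) F) p)
      = Polynomial.aeval (MvPolynomial.X 0 * MvPolynomial.X 1 : MvPolynomial (Fin 2) F) p := by
    rw [← Polynomial.aeval_algHom_apply, map_mul, hx, hy, hw]
  simp only [curvePoly, map_add, map_mul, map_sub, map_pow, hp]
  simp only [hx, hy, mul_pow, ← MvPolynomial.C_pow, inv_pow, h7, h14, inv_one, MvPolynomial.C_1,
    one_mul]

/-- The automorphism `s : x ↦ ζ x, y ↦ ζ⁻¹ y` of the coordinate ring. -/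
noncomputable def rotationRing {ζ : F} (hζ : IsPrimitiveRoot ζ 7) (φ ψ : Polynomial F) :
    curveRing φ ψ ≃ₐ[F] curveRing φ ψ :=
  Ideal.quotientEquivAlg _ _ (rotationPoly hζ) (by
    rw [Ideal.map_span, Set.image_singleton]
    exact congrArg (fun p => Ideal.span {p}) (rotationPoly_curvePoly hζ φ ψ).symm)

/-- The automorphism `s : x ↦ ζ x, y ↦ ζ⁻¹ y` of the function field `K`. -/
noncomputable def curveRotation {ζ : F} (hζ : IsPrimitiveRoot ζ 7) (φ ψ : Polynomial F)
    [Fact (Irreducible (curvePoly φ ψ))] : curveField φ ψ ≃ₐ[F] curveField φ ψ :=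
  IsFractionRing.fieldEquivOfAlgEquiv F (curveField φ ψ) (curveField φ ψ) (rotationRing hζ φ ψ)

/-- The function field of the quotient curve `X / C₇`: the fixed field `K ^ C₇` of the group
`C₇ = ⟨s⟩`. -/
noncomputable abbrev quotientField {ζ : F} (hζ : IsPrimitiveRoot ζ 7) (φ ψ : Polynomial F)
    [Fact (Irreducible (curvePoly φ ψ))] : IntermediateField F (curveField φ ψ) :=
  IntermediateField.fixedField (Subgroup.zpowers (curveRotation hζ φ ψ))

/-- The polynomial `τ(m) = (-ψ(m ^ 2 + a) + m c(m ^ 2 + a)) / 2`. -/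
noncomputable def tauPoly (ψ c : Polynomial F) (a : F) : Polynomial F :=
  Polynomial.C (2⁻¹ : F) *
    (-(ψ.comp (Polynomial.X ^ 2 + Polynomial.C a))
      + Polynomial.X * c.comp (Polynomial.X ^ 2 + Polynomial.C a))

end Curve

/-!
The fixed field of `C₇` is the function field of a hyperelliptic curve, whose genus is read off from
its equation.

Put `w = x y`, `v = x ^ 7 - y ^ 7` and `z = x ^ 7 + y ^ 7`. Then `4 f = (2 v + ψ(w)) ^ 2 -
(w - a) c(w) ^ 2`, so `m = (2 v + ψ(w)) / c(w)` satisfies `m ^ 2 = w - a` and `v = τ(m)`, and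
`z ^ 2 = v ^ 2 + 4 w ^ 7 = τ(m) ^ 2 + 4 (m ^ 2 + a) ^ 7 =: D(m)`. Averaging over the group shows
that the fixed field is `F(m, z)` (`exists_fixedField_generators`). The condition on the coefficient
of `w ^ 7` in `φ` says that `deg D = 14` (`natDegree_tauPoly_sq_add`). Write `D = q ^ 2 S` with `S`
squarefree, of degree `2 n = 14 - 2 deg q`; then `(z / q(m)) ^ 2 = S(m)`, and
`functionFieldGenus_of_sq_eq` gives the genus `n - 1`. It is `2` exactly if `deg S = 6` and
`deg q = 4`.

For the genus formula, the regular differentials of `z ^ 2 = S(m)` are shown to be the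
`p(m) dm / z` with `deg p ≤ n - 2`. That these are regular is a computation at each valuation ring
(`smul_mem_regularDifferentials`). Conversely, the derivation with `m ↦ z` preserves
`F[m, z] = F[m] + F[m] z`, the integral closure of `F[m]`, and therefore all its localizations at
maximal ideals; if `ω = h dm` is regular, its value `h z` at `ω` is thus in all these localizations,
hence in `F[m, z]` (`exists_smul_eq_of_mem_regularDifferentials`). The same statement for `m⁻¹` and
`z / m ^ n` controls the poles of `m`, and the two expressions together leave only the asserted
differentials. The argument does not require `z ∉ F(m)`: if `z ∈ F(m)`, then `S` is constant and
there are no nonzero regular differentials.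
-/

open Polynomial

/-! ### Square roots over a field of fractions -/

theorem exists_eq_add_mul_of_sq_eq {K L : Type*} [Field K] [Field L] [Algebra K L] {z : L} {s : K}
    (hz : z ^ 2 = algebraMap K L s) (htop : IntermediateField.adjoin K {z} = ⊤) (x : L) :
    ∃ a b : K, x = algebraMap K L a + algebraMap K L b * z := by
  have hint : IsIntegral K z := ⟨X ^ 2 - C s, monic_X_pow_sub_C _ two_ne_zero, by simp [hz]⟩
  have hx : x ∈ Algebra.adjoin K {z} := by
    rw [← IntermediateField.adjoin_simple_toSubalgebra_of_isAlgebraic hint.isAlgebraic, htop]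
    trivial
  induction hx using Algebra.adjoin_induction with
  | mem x hx => exact ⟨0, 1, by simp_all⟩
  | algebraMap r => exact ⟨r, 0, by simp⟩
  | add x y _ _ hx hy =>
    obtain ⟨a, b, rfl⟩ := hx
    obtain ⟨a', b', rfl⟩ := hy
    exact ⟨a + a', b + b', by simp only [map_add]; ring⟩
  | mul x y _ _ hx hy =>
    obtain ⟨a, b, rfl⟩ := hx
    obtain ⟨a', b', rfl⟩ := hy
    refine ⟨a * a' + b * b' * s, a * b' + a' * b, ?_⟩
    simp only [map_add, map_mul, ← hz]
    ring

/-- If `b ^ 2 * s` is integral and `s` is squarefree, then the denominator of `b` is trivial,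
because its square divides `s`. -/
theorem exists_algebraMap_eq_of_sq_mul_squarefree {A K : Type*} [CommRing A] [IsDomain A]
    [UniqueFactorizationMonoid A] [Field K] [Algebra A K] [IsFractionRing A K] {s c : A} {b : K}
    (hs : Squarefree s) (h : b ^ 2 * algebraMap A K s = algebraMap A K c) :
    ∃ b' : A, algebraMap A K b' = b := by
  have hd : algebraMap A K (IsFractionRing.den A b) ≠ 0 := by simp
  have hnd := IsFractionRing.mk'_num_den' (A := A) b
  have h1 : IsFractionRing.num A b ^ 2 * s = c * (IsFractionRing.den A b : A) ^ 2 := by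
    apply IsFractionRing.injective A K
    simp only [map_mul, map_pow]
    rw [← h, (div_eq_iff hd).1 hnd]
    ring
  have h2 : (IsFractionRing.den A b : A) ^ 2 ∣ s :=
    (((IsFractionRing.num_den_reduced A b).symm.pow_left).pow_right).dvd_of_dvd_mul_left
      ⟨c, by rw [h1]; ring⟩
  exact IsFractionRing.isInteger_of_isUnit_den (hs _ (by simpa [sq] using h2))

/-- The integral closure of `A` in the quadratic extension generated by the square root `z` of a
squarefree element is `A + A z`. The root `z` may lie in the ground field. -/
theorem exists_eq_add_mul_of_isIntegral {A K L : Type*} [CommRing A] [IsDomain A]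
    [UniqueFactorizationMonoid A] [Field K] [CharZero K] [Field L] [Algebra A K]
    [IsFractionRing A K] [Algebra A L] [Algebra K L] [IsScalarTower A K L]
    (h2 : IsUnit (2 : A)) {z : L} {s : A} (hs : Squarefree s)
    (hz : z ^ 2 = algebraMap A L s) (htop : IntermediateField.adjoin K {z} = ⊤) {x : L}
    (hx : IsIntegral A x) : ∃ a b : A, x = algebraMap A L a + algebraMap A L b * z := by
  have hzK : z ^ 2 = algebraMap K L (algebraMap A K s) := by
    rw [hz, ← IsScalarTower.algebraMap_apply]
  -- An integral element of `K` lies in `A`, since `A` is integrally closed.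
  have key (κ : K) (hκ : IsIntegral A (algebraMap K L κ)) : ∃ a : A, algebraMap A K a = κ :=
    IsIntegrallyClosed.isIntegral_iff.1
      ((isIntegral_algebraMap_iff (algebraMap K L).injective).1 hκ)
  obtain ⟨a, b, hab⟩ := exists_eq_add_mul_of_sq_eq hzK htop x
  by_cases hK : x ∈ (algebraMap K L).range
  · obtain ⟨κ, rfl⟩ := hK
    obtain ⟨a, rfl⟩ := key κ hx
    exact ⟨a, 0, by rw [← IsScalarTower.algebraMap_apply]; simp⟩
  -- Otherwise the minimal polynomial of `x = a + b z` is `X ^ 2 - 2 a X + (a ^ 2 - b ^ 2 s)`.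
  have hxK : IsIntegral K x := hx.tower_top
  have hdeg : 2 ≤ (minpoly K x).natDegree := (minpoly.two_le_natDegree_iff hxK).2 hK
  let q : K[X] := X ^ 2 + (C (-(2 * a)) * X + C (a ^ 2 - b ^ 2 * algebraMap A K s))
  have hqd : q.natDegree = 2 := by simp only [q]; compute_degree!
  have hqm : q.Monic := by simp only [q]; monicity!
  have hq0 : aeval x q = 0 := by
    simp only [q, map_add, map_mul, map_pow, aeval_X, aeval_C, map_sub, map_neg, ← hzK, map_ofNat]
    rw [hab]; ring
  have hmin : q = minpoly K x :=
    eq_of_monic_of_dvd_of_natDegree_le (minpoly.monic hxK) hqm (minpoly.dvd K x hq0)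
      (by rw [hqd]; exact hdeg)
  have hcoeff : q.coeff 1 = algebraMap A K ((minpoly A x).coeff 1) := by
    rw [hmin, ← coeff_map]
    exact congrArg (fun p => p.coeff 1) (minpoly.isIntegrallyClosed_eq_field_fractions K L hx)
  have hq1 : q.coeff 1 = -(2 * a) := by
    simp only [q, coeff_add, coeff_X_pow, coeff_C_mul, coeff_X, coeff_C]
    norm_num
  obtain ⟨u, hu⟩ := h2
  have hu' : (2 : K) * algebraMap A K ↑u⁻¹ = 1 := by
    have : algebraMap A K (u * ↑u⁻¹) = 1 := by simp
    rw [← this, map_mul, hu, map_ofNat]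
  obtain ⟨a', rfl⟩ : ∃ a' : A, algebraMap A K a' = a := by
    refine ⟨-(↑u⁻¹ * (minpoly A x).coeff 1), ?_⟩
    rw [map_neg, map_mul, ← hcoeff, hq1]
    linear_combination a * hu'
  have hbz : IsIntegral A (algebraMap K L b * z) := by
    have : algebraMap K L b * z = x - algebraMap A L a' := by
      rw [hab, ← IsScalarTower.algebraMap_apply]; ring
    rw [this]
    exact hx.sub isIntegral_algebraMap
  obtain ⟨c, hc⟩ := key (b ^ 2 * algebraMap A K s) (by
    have : algebraMap K L (b ^ 2 * algebraMap A K s) = (algebraMap K L b * z) ^ 2 := by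
      rw [map_mul, ← hzK, map_pow]; ring
    rw [this]
    exact hbz.pow 2)
  obtain ⟨b', rfl⟩ := exists_algebraMap_eq_of_sq_mul_squarefree hs hc.symm
  exact ⟨a', b', by rw [hab, ← IsScalarTower.algebraMap_apply, ← IsScalarTower.algebraMap_apply]⟩

/-! ### Valuation rings and derivations -/

/-- A derivation that maps a Dedekind domain to itself maps its localizations at maximal ideals to
themselves, by the quotient rule. -/
theorem valuation_derivation_le_one {k R L : Type*} [CommRing k] [CommRing R] [IsDedekindDomain R]
    [Field L] [Algebra R L] [IsFractionRing R L] [Algebra k L] (δ : Derivation k L L)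
    (hδ : ∀ r : R, ∃ r' : R, δ (algebraMap R L r) = algebraMap R L r')
    (v : IsDedekindDomain.HeightOneSpectrum R) {g : L} (hg : v.valuation L g ≤ 1) :
    v.valuation L (δ g) ≤ 1 := by
  obtain ⟨n, d, hnd⟩ := v.exists_primeCompl_mul_eq_of_integer g hg
  obtain ⟨n', hn'⟩ := hδ n
  obtain ⟨d', hd'⟩ := hδ d
  have hd : v.valuation L (algebraMap R L d) = 1 := (v.valuation_eq_one_iff_notMem).2 d.2
  have h := congrArg δ hnd
  rw [Derivation.leibniz, hn', hd', smul_eq_mul, smul_eq_mul] at h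
  have h2 : δ g * algebraMap R L d = algebraMap R L n' - g * algebraMap R L d' := by
    rw [← h]; ring
  have h3 : v.valuation L (δ g) = v.valuation L (algebraMap R L n' - g * algebraMap R L d') := by
    rw [← h2, map_mul, hd, mul_one]
  rw [h3]
  refine (Valuation.map_sub _ _ _).trans (max_le (v.valuation_le_one _) ?_)
  rw [map_mul]
  exact mul_le_one' hg (v.valuation_le_one _)

/-- A derivation that preserves a valuation ring, viewed as a functional on differentials, is
integral on the differentials that are regular there. -/
theorem liftKaehlerDifferential_mem_of_mem_span {k L : Type*} [Field k] [Field L] [Algebra k L]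
    (O : ValuationSubring L) (δ : Derivation k L L) (hδ : ∀ g ∈ O, δ g ∈ O) {ω : Ω[L⁄k]}
    (hω : ω ∈ Submodule.span O (KaehlerDifferential.D k L '' (O : Set L))) :
    δ.liftKaehlerDifferential ω ∈ O := by
  induction hω using Submodule.span_induction with
  | mem x hx =>
    obtain ⟨g, hg, rfl⟩ := hx
    rw [Derivation.liftKaehlerDifferential_comp_D]
    exact hδ g hg
  | zero => simp
  | add x y _ _ hx hy => rw [map_add]; exact add_mem hx hy
  | smul a x _ hx =>
    have : a • x = (a : L) • x := rfl
    rw [this, map_smul]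
    exact mul_mem a.2 hx

/-! ### Differentials of a hyperelliptic function field -/

section Hyperelliptic

variable {F L : Type*} [Field F] [Field L] [Algebra F L] {m z : L} {S : F[X]}

/-- If `L` is a separable algebraic extension of `F(m)`, then `Ω[L⁄F]` has basis `dm`, because
`L` is formally étale over `F[m]`. Here `l` is the coordinate with respect to this basis. -/
theorem exists_linearMap_kaehlerDifferential [Algebra F[X] L] [IsScalarTower F F[X] L]
    [Algebra (FractionRing F[X]) L] [IsScalarTower F[X] (FractionRing F[X]) L]
    [Algebra.IsSeparable (FractionRing F[X]) L] :
    ∃ l : Ω[L⁄F] →ₗ[L] L, l (KaehlerDifferential.D F L (algebraMap F[X] L X)) = 1 ∧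
      ∀ ω, ω = l ω • KaehlerDifferential.D F L (algebraMap F[X] L X) := by
  have : Algebra.FormallyEtale F[X] (FractionRing F[X]) :=
    Algebra.FormallyEtale.of_isLocalization (nonZeroDivisors F[X])
  have : Algebra.FormallyEtale (FractionRing F[X]) L := Algebra.FormallyEtale.of_isSeparable _ _
  have : Algebra.FormallyEtale F[X] L := Algebra.FormallyEtale.comp _ (FractionRing F[X]) _
  have hbc := KaehlerDifferential.isBaseChange_of_formallyEtale F F[X] L
  let l := hbc.lift
    (Algebra.linearMap F[X] L ∘ₗ (KaehlerDifferential.polynomialEquiv F).toLinearMap)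
  have hl : l (KaehlerDifferential.D F L (algebraMap F[X] L X)) = 1 := by
    rw [← KaehlerDifferential.map_D F F]
    refine (hbc.lift_eq _ _).trans ?_
    simp
  refine ⟨l, hl, fun ω => ?_⟩
  induction ω using hbc.inductionOn with
  | zero => simp
  | tmul η =>
    obtain ⟨p, rfl⟩ := (KaehlerDifferential.polynomialEquiv F).symm.surjective η
    rw [KaehlerDifferential.polynomialEquiv_symm, map_smul, KaehlerDifferential.map_D,
      ← algebraMap_smul L p, map_smul, hl, smul_eq_mul, mul_one]
  | smul s ω h => rw [map_smul, smul_eq_mul, mul_smul, ← h]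
  | add ω ω' h h' => rw [map_add, add_smul, ← h, ← h']

variable [CharZero F]

/-- In the function field `F(m, z)` with `z ^ 2 = S(m)`, `S` squarefree, a differential that is
regular over the finite points of the `m`-line is `(A(m) + B(m) z) dm / z` with polynomials `A`
and `B`: the derivation with `m ↦ z` preserves the Dedekind domain `F[m, z]`, hence all its local
rings, so its values on such differentials lie in `F[m, z]`. Moreover `dm ≠ 0`. -/
theorem exists_smul_eq_of_mem_regularDifferentials (hm : Transcendental F m) (hS : Squarefree S)
    (hz : z ^ 2 = aeval m S) (htop : IntermediateField.adjoin F {m, z} = ⊤) :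
    KaehlerDifferential.D F L m ≠ 0 ∧
    ∀ ω ∈ regularDifferentials F L, ∃ A B : F[X],
        z • ω = (aeval m A + aeval m B * z) • KaehlerDifferential.D F L m := by
  let : Algebra F[X] L := (aeval m).toAlgebra
  have hA (p : F[X]) : algebraMap F[X] L p = aeval m p := rfl
  have : IsScalarTower F F[X] L := IsScalarTower.of_algebraMap_eq fun c => by
    rw [hA, algebraMap_eq, aeval_C]
  have : FaithfulSMul F[X] L :=
    (faithfulSMul_iff_algebraMap_injective _ _).2 (transcendental_iff_injective.1 hm)
  let : Algebra (FractionRing F[X]) L := FractionRing.liftAlgebra F[X] L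
  have : IsScalarTower F (FractionRing F[X]) L := IsScalarTower.of_algebraMap_eq fun c => by
    rw [IsScalarTower.algebraMap_apply F F[X] (FractionRing F[X]),
      ← IsScalarTower.algebraMap_apply F[X] (FractionRing F[X]) L,
      ← IsScalarTower.algebraMap_apply F F[X] L]
  have htopK : IntermediateField.adjoin (FractionRing F[X]) {z} = ⊤ := by
    rw [← IntermediateField.restrictScalars_eq_top_iff (K := F), eq_top_iff, ← htop,
      IntermediateField.adjoin_le_iff]
    rintro x (rfl | rfl)
    · have : x = algebraMap (FractionRing F[X]) L (algebraMap F[X] _ X) := by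
        rw [← IsScalarTower.algebraMap_apply, hA, aeval_X]
      rw [this]
      exact IntermediateField.algebraMap_mem (IntermediateField.adjoin (FractionRing F[X]) {z}) _
    · exact IntermediateField.mem_adjoin_simple_self (FractionRing F[X]) x
  have zint : IsIntegral F[X] z :=
    ⟨X ^ 2 - C S, monic_X_pow_sub_C _ two_ne_zero, by simp [hz, hA]⟩
  have : FiniteDimensional (FractionRing F[X]) L := by
    have h := IntermediateField.adjoin.finiteDimensional (K := FractionRing F[X])
      (zint.tower_top (A := FractionRing F[X]))
    rw [htopK] at h
    exact IntermediateField.topEquiv.toLinearEquiv.finiteDimensional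
  have hX : algebraMap F[X] L X = m := by rw [hA, aeval_X]
  obtain ⟨l, hl1, hl⟩ := exists_linearMap_kaehlerDifferential (F := F) (L := L)
  rw [hX] at hl1 hl
  refine ⟨fun h => by simp [h] at hl1, fun ω hω => ?_⟩
  let δ : Derivation F L L := (z • l).compDer (KaehlerDifferential.D F L)
  have hδm : δ m = z := by
    exact (congrArg (z * ·) hl1).trans (mul_one z)
  have hδA (p : F[X]) : δ (aeval m p) = aeval m (derivative p) * z := by
    rw [Derivation.map_aeval, hδm, smul_eq_mul]
  have hz0 : z ≠ 0 := by
    rintro rfl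
    rw [zero_pow two_ne_zero] at hz
    exact hS.ne_zero (transcendental_iff.1 hm S hz.symm)
  have hδz : δ z = aeval m (C 2⁻¹ * derivative S) := by
    have h := congrArg δ hz
    rw [Derivation.leibniz_pow, hδA] at h
    have h2 : z * (2 * δ z) = z * aeval m (derivative S) := by
      simpa [mul_comm, mul_left_comm] using h
    rw [map_mul, aeval_C, ← mul_left_cancel₀ hz0 h2, map_inv₀, map_ofNat,
      inv_mul_cancel_left₀ (by
        rw [← map_ofNat (algebraMap F L)]
        exact (_root_.map_ne_zero _).2 two_ne_zero)]
  have hDed : IsDedekindDomain (integralClosure F[X] L) :=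
    integralClosure.isDedekindDomain F[X] (FractionRing F[X]) L
  have : IsFractionRing (integralClosure F[X] L) L :=
    integralClosure.isFractionRing_of_finite_extension (FractionRing F[X]) L
  have two : IsUnit (2 : F[X]) := by
    have := (isUnit_C (R := F)).2 (isUnit_iff_ne_zero.2 (two_ne_zero (α := F)))
    rwa [map_ofNat] at this
  have hint {x : L} (hx : IsIntegral F[X] x) :
      ∃ A B : F[X], x = aeval m A + aeval m B * z :=
    exists_eq_add_mul_of_isIntegral (K := FractionRing F[X]) two hS hz htopK hx
  have hδint (r : integralClosure F[X] L) :
      ∃ r' : integralClosure F[X] L, δ (algebraMap _ L r) = algebraMap _ L r' := by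
    obtain ⟨A, B, hAB⟩ := hint r.2
    have h1 : δ (r : L) = aeval m (derivative B * S + B * (C 2⁻¹ * derivative S))
        + aeval m (derivative A) * z := by
      rw [hAB, map_add, Derivation.leibniz, hδA, hδA, hδz]
      simp only [map_add, map_mul, smul_eq_mul, ← hz]
      ring
    refine ⟨⟨δ r, ?_⟩, rfl⟩
    rw [h1]
    exact (isIntegral_algebraMap (x := (_ : F[X]))).add
      ((isIntegral_algebraMap (x := derivative A)).mul zint)
  have hlift : δ.liftKaehlerDifferential ω = z * l ω := by
    conv_lhs => rw [hl ω]
    rw [map_smul, Derivation.liftKaehlerDifferential_comp_D, hδm, smul_eq_mul, mul_comm]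
  have hmem : z * l ω ∈ (algebraMap (integralClosure F[X] L) L).range := by
    refine IsDedekindDomain.HeightOneSpectrum.mem_integers_of_valuation_le_one L _ fun v => ?_
    rw [← hlift]
    refine liftKaehlerDifferential_mem_of_mem_span (v.valuation L).valuationSubring δ
      (fun g hg => valuation_derivation_le_one δ hδint v hg) (hω _ fun c => ?_)
    exact v.valuation_le_one (algebraMap F (integralClosure F[X] L) c)
  obtain ⟨r, hr⟩ := hmem
  obtain ⟨A, B, hAB⟩ := hint r.2
  refine ⟨A, B, ?_⟩
  conv_lhs => rw [hl ω]
  rw [smul_smul, ← hr, ← hAB]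
  rfl

end Hyperelliptic

/-! ### The genus of a hyperelliptic function field -/

section Hyperelliptic

variable {F L : Type*} [Field F] [Field L] [Algebra F L] {m z : L} {S : F[X]}

theorem aeval_inv_reflect_mul_pow {x : L} (hx : x ≠ 0) {N : ℕ} {p : F[X]} (hp : p.natDegree ≤ N) :
    aeval x⁻¹ (reflect N p) * x ^ N = aeval x p := by
  let := invertibleOfNonzero hx
  have := eval₂_reflect_mul_pow (algebraMap F L) x N p hp
  rwa [invOf_eq_inv] at this

theorem ValuationSubring.aeval_mem (O : ValuationSubring L) (hO : ∀ c : F, algebraMap F L c ∈ O)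
    {x : L} (hx : x ∈ O) (p : F[X]) : aeval x p ∈ O := by
  rw [aeval_eq_sum_range]
  refine sum_mem fun i _ => ?_
  rw [Algebra.smul_def]
  exact O.mul_mem _ _ (hO _) (pow_mem hx _)

/-- At a place where `t` vanishes, a square root of a polynomial in `t` with nonzero constant
coefficient is a unit. -/
theorem ValuationSubring.inv_mem_of_sq_eq_aeval (O : ValuationSubring L)
    (hO : ∀ c : F, algebraMap F L c ∈ O) {t w : L} (ht : O.valuation t < 1) {R : F[X]}
    (hR : R.coeff 0 ≠ 0) (hw : w ^ 2 = aeval t R) : w⁻¹ ∈ O := by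
  have hc : O.valuation (algebraMap F L (R.coeff 0)) = 1 := by
    refine le_antisymm ((O.valuation_le_one_iff _).2 (hO _)) ?_
    have h1 := (O.valuation_le_one_iff _).2 (hO (R.coeff 0)⁻¹)
    rw [map_inv₀, map_inv₀] at h1
    exact (inv_le_one₀ (zero_lt_iff.2 (by simpa using hR))).1 h1
  have htO : t ∈ O := (O.valuation_le_one_iff _).1 ht.le
  have h1 : O.valuation (t * aeval t (divX R)) < 1 := by
    rw [map_mul]
    exact mul_lt_one_of_lt_of_le ht ((O.valuation_le_one_iff _).2 (O.aeval_mem hO htO _))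
  have h2 : O.valuation (w ^ 2) = 1 := by
    rw [hw, ← divX_mul_X_add R, map_add, map_mul, aeval_X, aeval_C, mul_comm,
      Valuation.map_add_eq_of_lt_right _ (by rwa [hc]), hc]
  rw [← O.valuation_le_one_iff, map_inv₀]
  have h3 : O.valuation w = 1 := by
    rw [map_pow] at h2
    exact (pow_eq_one_iff_of_nonneg zero_le two_ne_zero).1 h2
  simp [h3]

theorem squarefree_reverse {S : F[X]} (hS : Squarefree S) :
    Squarefree S.reverse := by
  rintro g ⟨k, hk⟩
  have h0 : S.reverse.coeff 0 ≠ 0 := by simpa using hS.ne_zero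
  have hS0 : S.reverse ≠ 0 := by simpa using hS.ne_zero
  have hg0 : g.coeff 0 ≠ 0 := fun h => h0 (by rw [hk, mul_coeff_zero, mul_coeff_zero, h]; simp)
  have hg : g ≠ 0 := fun h => hg0 (by simp [h])
  have hk0 : k ≠ 0 := fun h => hS0 (by rw [hk, h, mul_zero])
  have hdeg : g.natDegree + g.natDegree + k.natDegree ≤ S.natDegree := by
    rw [← natDegree_mul hg hg, ← natDegree_mul (mul_ne_zero hg hg) hk0, ← hk]
    exact S.reverse_natDegree_le
  have h1 : S = reflect g.natDegree g * reflect g.natDegree g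
      * reflect (S.natDegree - (g.natDegree + g.natDegree)) k := by
    rw [← reflect_mul _ _ le_rfl le_rfl, ← reflect_mul _ _ natDegree_mul_le (by omega), ← hk,
      Nat.add_sub_of_le (by omega), reverse, reflect_reflect]
  have h2 : IsUnit g.reverse := hS _ ⟨_, h1⟩
  have h3 := reverse_natDegree g
  rw [natDegree_eq_zero_of_isUnit h2, natTrailingDegree_eq_zero_of_constantCoeff_ne_zero hg0,
    Nat.sub_zero] at h3
  rw [isUnit_iff_degree_eq_zero, degree_eq_natDegree hg, ← h3, Nat.cast_zero]

/-- If the squarefree polynomial `S` is not a square, then `1` and a root of `S(m)` are linearly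
independent over `F(m)`. -/
theorem eq_zero_of_aeval_add_mul_eq_zero (hm : Transcendental F m) (hz : z ^ 2 = aeval m S)
    (hsq : ¬ IsSquare S) {P Q : F[X]} (h : aeval m P + aeval m Q * z = 0) : P = 0 ∧ Q = 0 := by
  have h1 : P ^ 2 = Q ^ 2 * S := by
    apply transcendental_iff_injective.1 hm
    simp only [map_mul, map_pow, ← hz]
    linear_combination (aeval m P - aeval m Q * z) * h
  have hQ : Q = 0 := by
    by_contra hQ
    obtain ⟨k, rfl⟩ := (UniqueFactorizationMonoid.pow_dvd_pow_iff_dvd two_ne_zero).1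
      (Dvd.intro _ h1.symm)
    exact hsq ⟨k, by
      rw [mul_pow] at h1
      rw [← mul_left_cancel₀ (pow_ne_zero 2 hQ) h1, sq]⟩
  subst hQ
  simpa using h1

variable [CharZero F]

/-- The differentials `p(m) dm / z` with `deg p ≤ n - 2` are regular on the hyperelliptic curve
`z ^ 2 = S(m)`, `deg S = 2 n`. Where `m` is finite, `dm / z = a(m) z dm + 2 b(m) dz` with
`a S + b S' = 1`; where `m` has a pole, `t = m⁻¹` and `w = z t ^ n` are regular, `w` is a unit, and
`p(m) dm / z = - p(m) t ^ (n - 2) dt / w`. -/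
theorem smul_mem_regularDifferentials (hm0 : m ≠ 0) (hz0 : z ≠ 0) (hS : Squarefree S)
    (hz : z ^ 2 = aeval m S) {n : ℕ} (hn : S.natDegree = 2 * n) {p : F[X]}
    (hp : p.natDegree + 2 ≤ n) :
    (aeval m p / z) • KaehlerDifferential.D F L m ∈ regularDifferentials F L := by
  intro O hO
  have hD {g : L} (hg : g ∈ O) : KaehlerDifferential.D F L g ∈
      Submodule.span O (KaehlerDifferential.D F L '' (O : Set L)) :=
    Submodule.subset_span ⟨g, hg, rfl⟩
  have hsmul {a : L} (ha : a ∈ O) {η : Ω[L⁄F]}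
      (hη : η ∈ Submodule.span O (KaehlerDifferential.D F L '' (O : Set L))) :
      a • η ∈ Submodule.span O (KaehlerDifferential.D F L '' (O : Set L)) :=
    Submodule.smul_mem _ (⟨a, ha⟩ : O) hη
  have hsq {x : L} (hx : x ^ 2 ∈ O) : x ∈ O := by
    rcases O.mem_or_inv_mem x with h | h
    · exact h
    · have h2 := mul_mem hx h
      rcases eq_or_ne x 0 with rfl | h0
      · exact zero_mem _
      · rwa [sq, mul_assoc, mul_inv_cancel₀ h0, mul_one] at h2
  by_cases hm : m ∈ O
  · obtain ⟨a, b, hab⟩ := PerfectField.separable_iff_squarefree.2 hS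
    have hzO : z ∈ O := hsq (hz ▸ O.aeval_mem hO hm S)
    have hdz : (2 * z) • KaehlerDifferential.D F L z
        = aeval m (derivative S) • KaehlerDifferential.D F L m := by
      rw [← Derivation.map_aeval, ← hz, Derivation.leibniz_pow]
      simp [mul_smul, ofNat_smul_eq_nsmul]
    have key : (aeval m p / z) • KaehlerDifferential.D F L m
        = (aeval m (p * a) * z) • KaehlerDifferential.D F L m
          + aeval m (2 * p * b) • KaehlerDifferential.D F L z := by
      apply smul_right_injective _ hz0
      have hab' : aeval m a * z ^ 2 + aeval m b * aeval m (derivative S) = 1 := by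
        rw [hz, ← map_mul, ← map_mul, ← map_add, hab, map_one]
      have h1 : z * aeval m (2 * p * b) = aeval m (p * b) * (2 * z) := by
        simp only [map_mul, map_ofNat]; ring
      simp only [smul_add, smul_smul]
      rw [h1, mul_smul (aeval m (p * b)), hdz, smul_smul, ← add_smul, mul_div_cancel₀ _ hz0]
      congr 1
      simp only [map_mul]
      linear_combination -aeval m p * hab'
    rw [key]
    exact add_mem (hsmul (mul_mem (O.aeval_mem hO hm _) hzO) (hD hm))
      (hsmul (O.aeval_mem hO hm _) (hD hzO))
  · have ht : m⁻¹ ∈ O := (O.mem_or_inv_mem m).resolve_left hm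
    have htv : O.valuation m⁻¹ < 1 := by
      rw [← O.valuation_le_one_iff, not_le] at hm
      rw [map_inv₀]
      exact inv_lt_one_of_one_lt₀ hm
    have hR := aeval_inv_reflect_mul_pow hm0 (le_refl S.natDegree)
    have hw : (z * m⁻¹ ^ n) ^ 2 = aeval m⁻¹ (reflect S.natDegree S) := by
      rw [mul_pow, hz, ← hR, ← pow_mul, mul_comm n 2, ← hn, mul_assoc, ← mul_pow,
        mul_inv_cancel₀ hm0, one_pow, mul_one]
    have hwO := O.inv_mem_of_sq_eq_aeval hO htv (R := reflect S.natDegree S)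
      (by simpa [coeff_reflect] using hS.ne_zero) hw
    obtain ⟨N, rfl⟩ := Nat.exists_eq_add_of_le' hp
    have hp' := aeval_inv_reflect_mul_pow hm0 (p := p) (N := N + p.natDegree) (by omega)
    have key : (aeval m p / z) • KaehlerDifferential.D F L m
        = -((aeval m⁻¹ (reflect (N + p.natDegree) p) * (z * m⁻¹ ^ (N + (p.natDegree + 2)))⁻¹)
          • KaehlerDifferential.D F L m⁻¹) := by
      rw [Derivation.leibniz_inv, ← neg_smul, smul_smul, ← hp']
      congr 1
      have hN : (m⁻¹ ^ (N + (p.natDegree + 2)))⁻¹ = m ^ (N + p.natDegree) * m ^ 2 := by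
        rw [← inv_pow, inv_inv, ← add_assoc, pow_add]
      rw [mul_inv, hN]
      generalize aeval m⁻¹ (reflect (N + p.natDegree) p) = r
      field_simp
    rw [key]
    exact neg_mem (hsmul (mul_mem (O.aeval_mem hO ht _) hwO) (hD ht))

/-- Every regular differential is `p(m) dm / z` with `deg p ≤ n - 2`: this compares its expressions
over the `m`-line and over the `m⁻¹`-line. -/
theorem exists_natDegree_le_of_mem_regularDifferentials (hm : Transcendental F m)
    (hS : Squarefree S) (hz : z ^ 2 = aeval m S)
    (htop : IntermediateField.adjoin F {m, z} = ⊤) {n : ℕ} (hn : S.natDegree = 2 * n)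
    {ω : Ω[L⁄F]} (hω : ω ∈ regularDifferentials F L) :
    ∃ p : F[X], (p = 0 ∨ p.natDegree + 2 ≤ n) ∧
      z • ω = aeval m p • KaehlerDifferential.D F L m := by
  have hm0 : m ≠ 0 := fun h => hm (h ▸ isAlgebraic_zero)
  obtain ⟨hDm, hfin⟩ := exists_smul_eq_of_mem_regularDifferentials hm hS hz htop
  have hw : (z * m⁻¹ ^ n) ^ 2 = aeval m⁻¹ S.reverse := by
    rw [mul_pow, hz, ← aeval_inv_reflect_mul_pow hm0 (le_refl S.natDegree), ← pow_mul, mul_comm n 2,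
      ← hn, mul_assoc, ← mul_pow, mul_inv_cancel₀ hm0, one_pow, mul_one, reverse]
  have htop' : IntermediateField.adjoin F {m⁻¹, z * m⁻¹ ^ n} = ⊤ := by
    have h1 : m⁻¹ ∈ IntermediateField.adjoin F {m⁻¹, z * m⁻¹ ^ n} :=
      IntermediateField.subset_adjoin _ _ (by simp)
    have h2 : z * m⁻¹ ^ n ∈ IntermediateField.adjoin F {m⁻¹, z * m⁻¹ ^ n} :=
      IntermediateField.subset_adjoin _ _ (by simp)
    rw [eq_top_iff, ← htop, IntermediateField.adjoin_le_iff]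
    rintro x (rfl | rfl)
    · simpa using inv_mem h1
    · simpa [hm0] using div_mem h2 (pow_mem h1 n)
  obtain ⟨-, hinf⟩ := exists_smul_eq_of_mem_regularDifferentials
    (fun h => hm (by simpa using h.inv)) (squarefree_reverse hS) hw htop'
  obtain ⟨A, B, hAB⟩ := hfin ω hω
  obtain ⟨A', B', hAB'⟩ := hinf ω hω
  -- Comparison of the coefficients of `dm`, after multiplication by `m ^ (N + n + 2)`.
  have hcmp : m⁻¹ ^ n * (aeval m A + aeval m B * z)
      = (aeval m⁻¹ A' + aeval m⁻¹ B' * (z * m⁻¹ ^ n)) * (-m⁻¹ ^ 2) := by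
    apply smul_left_injective L hDm
    simp only [mul_smul]
    rw [← hAB, ← Derivation.leibniz_inv, ← hAB', smul_smul, mul_comm]
  let N := max A'.natDegree B'.natDegree
  have hrefl {p : F[X]} (hp : p.natDegree ≤ N) :
      aeval m⁻¹ p * m ^ N = aeval m (reflect N p) := by
    have := aeval_inv_reflect_mul_pow hm0 (p := reflect N p) (N := N)
      (natDegree_reflect_le.trans (max_le le_rfl hp))
    rwa [reflect_reflect] at this
  have hA' := hrefl (p := A') (le_max_left _ _)
  have hB' := hrefl (p := B') (le_max_right _ _)
  have hdeg {p : F[X]} (hp : p.natDegree ≤ N) : (reflect N p).natDegree ≤ N :=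
    natDegree_reflect_le.trans (max_le le_rfl hp)
  have hdA := hdeg (p := A') (le_max_left _ _)
  have hdB := hdeg (p := B') (le_max_right _ _)
  have hzero : aeval m (X ^ (N + 2) * A + X ^ n * reflect N A')
      + aeval m (X ^ (N + 2) * B + reflect N B') * z = 0 := by
    simp only [map_add, map_mul, map_pow, aeval_X, ← hA', ← hB']
    have hmn : m⁻¹ ^ n * m ^ n = 1 := by rw [← mul_pow, inv_mul_cancel₀ hm0, one_pow]
    have hm2 : m⁻¹ ^ 2 * m ^ 2 = 1 := by rw [← mul_pow, inv_mul_cancel₀ hm0, one_pow]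
    linear_combination m ^ (N + n + 2) * hcmp
      - m ^ (N + 2) * (aeval m A + aeval m B * z) * hmn
      - m ^ (N + n) * (aeval m⁻¹ A' + aeval m⁻¹ B' * (z * m⁻¹ ^ n)) * hm2
      - m ^ N * aeval m⁻¹ B' * z * hmn
  have hlarge {P Q : F[X]} {k : ℕ} (hQ : Q.natDegree ≤ N) (h : X ^ (N + 2) * P + X ^ k * Q = 0) :
      P = 0 ∨ P.natDegree + 2 ≤ k := by
    refine or_iff_not_imp_left.2 fun hP => ?_
    have h1 := congrArg natDegree (eq_neg_of_add_eq_zero_left h)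
    rw [natDegree_neg, natDegree_mul (by simp) hP, natDegree_X_pow] at h1
    have h2 := natDegree_mul_le (p := X ^ k) (q := Q)
    rw [natDegree_X_pow] at h2
    omega
  by_cases hsq : IsSquare S
  · -- Here `S` is constant, so that `z` lies in `F`.
    obtain ⟨k, rfl⟩ := hsq
    have hk : IsUnit k := hS k dvd_rfl
    have hk0 := natDegree_eq_zero_of_isUnit hk
    obtain rfl : n = 0 := by
      rw [natDegree_mul hk.ne_zero hk.ne_zero, hk0] at hn
      omega
    obtain ⟨k', hk', hzk⟩ : ∃ k' : F[X], k'.natDegree = 0 ∧ z = aeval m k' := by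
      rw [← sq, map_pow] at hz
      rcases sq_eq_sq_iff_eq_or_eq_neg.1 hz with h | h
      · exact ⟨k, hk0, h⟩
      · exact ⟨-k, by rwa [natDegree_neg], by rw [h, map_neg]⟩
    refine ⟨A + B * k', hlarge (Q := reflect N A' + reflect N B' * k') ?_ ?_, ?_⟩
    · refine (natDegree_add_le _ _).trans (max_le hdA (natDegree_mul_le.trans ?_))
      omega
    · apply transcendental_iff_injective.1 hm
      rw [map_zero, ← hzero, hzk]
      simp only [map_add, map_mul, map_pow, aeval_X]
      ring
    · rw [hAB, hzk]
      simp only [map_add, map_mul]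
  · obtain ⟨h1, h2⟩ := eq_zero_of_aeval_add_mul_eq_zero hm hz hsq hzero
    have hB : B = 0 := (hlarge (k := 0) hdB (by rwa [pow_zero, one_mul])).resolve_right (by omega)
    exact ⟨A, hlarge hdA h1, by rw [hAB, hB, map_zero, zero_mul, add_zero]⟩

/-- The hyperelliptic curve `z ^ 2 = S(m)` with `S` squarefree of degree `2 n` has genus `n - 1`.
For `n = 0` the truncated subtraction gives the correct value `0`. -/
theorem functionFieldGenus_of_sq_eq (hm : Transcendental F m)
    (hS : Squarefree S) (hz : z ^ 2 = aeval m S)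
    (htop : IntermediateField.adjoin F {m, z} = ⊤) {n : ℕ} (hn : S.natDegree = 2 * n) :
    functionFieldGenus F L = n - 1 := by
  have hm0 : m ≠ 0 := fun h => hm (h ▸ isAlgebraic_zero)
  have hz0 : z ≠ 0 := by
    rintro rfl
    rw [zero_pow two_ne_zero] at hz
    exact hS.ne_zero (transcendental_iff.1 hm S hz.symm)
  obtain ⟨hDm, -⟩ := exists_smul_eq_of_mem_regularDifferentials hm hS hz htop
  let l : F[X] →ₗ[F] Ω[L⁄F] :=
    { toFun := fun p => (aeval m p / z) • KaehlerDifferential.D F L m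
      map_add' := fun p q => by rw [map_add, add_div, add_smul]
      map_smul' := fun c p => by rw [map_smul, smul_div_assoc, smul_assoc, RingHom.id_apply] }
  have hl : Function.Injective l := fun p q h => by
    have h1 := smul_left_injective L hDm h
    exact transcendental_iff_injective.1 hm ((div_left_inj' hz0).1 h1)
  have hreg : regularDifferentials F L = (degreeLT F (n - 1)).map l := by
    have hlt (p : F[X]) : p ∈ degreeLT F (n - 1) ↔ p = 0 ∨ p.natDegree + 2 ≤ n := by
      rw [mem_degreeLT]
      rcases eq_or_ne p 0 with rfl | hp
      · simp
      · rw [degree_eq_natDegree hp, Nat.cast_lt]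
        simp only [hp, false_or]
        omega
    refine le_antisymm (fun ω hω => ?_) ?_
    · obtain ⟨p, hp, hpω⟩ := exists_natDegree_le_of_mem_regularDifferentials hm hS hz htop hn hω
      refine ⟨p, (hlt p).2 hp, ?_⟩
      change (aeval m p / z) • KaehlerDifferential.D F L m = ω
      rw [div_eq_inv_mul, mul_smul, ← hpω, inv_smul_smul₀ hz0]
    · rintro _ ⟨p, hp, rfl⟩
      rcases (hlt p).1 hp with rfl | hp
      · rw [map_zero]; exact zero_mem _
      · exact smul_mem_regularDifferentials hm0 hz0 hS hz hn hp
  rw [functionFieldGenus, hreg, (Submodule.equivMapOfInjective l hl _).symm.finrank_eq,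
    (degreeLTEquiv F (n - 1)).finrank_eq, Module.finrank_fin_fun]

end Hyperelliptic

/-! ### The function field of the plane curve -/

section PlaneCurve

variable {F : Type*} [Field F]

/-- The evaluation `p ↦ p(x, y)` of polynomials in the function field of the curve. -/
noncomputable def curveEval (φ ψ : F[X]) : MvPolynomial (Fin 2) F →ₐ[F] curveField φ ψ :=
  (IsScalarTower.toAlgHom F (curveRing φ ψ) (curveField φ ψ)).comp
    (Ideal.Quotient.mkₐ F (Ideal.span {curvePoly φ ψ}))

theorem curveEval_eq_zero_iff (φ ψ : F[X]) (p : MvPolynomial (Fin 2) F) :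
    curveEval φ ψ p = 0 ↔ curvePoly φ ψ ∣ p := by
  change algebraMap (curveRing φ ψ) (curveField φ ψ) (Ideal.Quotient.mk _ p) = 0 ↔ _
  rw [FaithfulSMul.algebraMap_eq_zero_iff, Ideal.Quotient.eq_zero_iff_mem,
    Ideal.mem_span_singleton]

variable (φ ψ : F[X])

/-- The coordinate `x` is transcendental, since the equation of the curve is monic in `y`, also
after specializing `x`. -/
theorem transcendental_curveEval_X_zero [Infinite F] (hφ : φ.natDegree ≤ 7) (hψ : ψ.natDegree ≤ 3) :
    Transcendental F (curveEval φ ψ (MvPolynomial.X 0)) := by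
  rw [transcendental_iff]
  intro P hP
  by_contra hP0
  obtain ⟨ξ, hξ⟩ : ∃ ξ, P.eval ξ ≠ 0 := by
    by_contra! h
    exact hP0 (Polynomial.funext fun r => by rw [h r, eval_zero])
  rw [Polynomial.aeval_algHom_apply, curveEval_eq_zero_iff] at hP
  let θ : MvPolynomial (Fin 2) F →ₐ[F] F[X] := MvPolynomial.aeval ![C ξ, X]
  have hθ0 : θ (MvPolynomial.X 0) = C ξ := by simp [θ]
  have hθ1 : θ (MvPolynomial.X 1) = X := by simp [θ]
  have hdvd : θ (curvePoly φ ψ) ∣ C (P.eval ξ) := by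
    have h := map_dvd θ hP
    rwa [← Polynomial.aeval_algHom_apply, hθ0, ← algebraMap_eq, aeval_algebraMap_apply,
      coe_aeval_eq_eval] at h
  have hunit : IsUnit (θ (curvePoly φ ψ)) :=
    isUnit_of_dvd_unit hdvd (isUnit_C.2 (isUnit_iff_ne_zero.2 hξ))
  have hcomp (p : F[X]) : (aeval (C ξ * X) p : F[X]).natDegree ≤ p.natDegree := by
    refine (natDegree_comp_le (p := p) (q := C ξ * X)).trans ?_
    exact (Nat.mul_le_mul_left _ ((natDegree_C_mul_le ξ X).trans natDegree_X_le)).trans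
      (mul_one _).le
  have hrest : (C ξ ^ 14 + aeval (C ξ * X) φ + (C ξ ^ 7 - X ^ 7) * aeval (C ξ * X) ψ).natDegree
      ≤ 10 := by
    have h1 := hcomp φ
    have h2 := hcomp ψ
    refine natDegree_add_le_of_degree_le (natDegree_add_le_of_degree_le ?_ (by omega)) ?_
    · rw [← C_pow, natDegree_C]; omega
    · refine natDegree_mul_le.trans ?_
      have : (C ξ ^ 7 - X ^ 7 : F[X]).natDegree ≤ 7 := by
        rw [← C_pow]
        exact (natDegree_sub_le _ _).trans
          (max_le ((natDegree_C _).le.trans (by norm_num)) (natDegree_X_pow_le 7))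
      omega
  have hθ : θ (curvePoly φ ψ) = X ^ 14
      + (C ξ ^ 14 + aeval (C ξ * X) φ + (C ξ ^ 7 - X ^ 7) * aeval (C ξ * X) ψ) := by
    simp only [curvePoly, map_add, map_mul, map_sub, map_pow, ← Polynomial.aeval_algHom_apply, hθ0,
      hθ1]
    ring
  have hdeg := natDegree_eq_zero_of_isUnit hunit
  rw [hθ, natDegree_add_eq_left_of_natDegree_lt (by rw [natDegree_X_pow]; omega),
    natDegree_X_pow] at hdeg
  omega

variable [Fact (Irreducible (curvePoly φ ψ))]

theorem adjoin_curveEval_eq_top : IntermediateField.adjoin F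
    {curveEval φ ψ (MvPolynomial.X 0), curveEval φ ψ (MvPolynomial.X 1)} = ⊤ := by
  rw [eq_top_iff]
  rintro k -
  have hp (p : MvPolynomial (Fin 2) F) : curveEval φ ψ p ∈ IntermediateField.adjoin F
      {curveEval φ ψ (MvPolynomial.X 0), curveEval φ ψ (MvPolynomial.X 1)} := by
    induction p using MvPolynomial.induction_on with
    | C r =>
      have : curveEval φ ψ (MvPolynomial.C r) = algebraMap F _ r := (curveEval φ ψ).commutes r
      rw [this]
      exact IntermediateField.algebraMap_mem _ _
    | add p q hp hq => rw [map_add]; exact add_mem hp hq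
    | mul_X p i hp =>
      rw [map_mul]
      refine mul_mem hp (IntermediateField.subset_adjoin _ _ ?_)
      fin_cases i <;> simp
  obtain ⟨r, s, -, rfl⟩ := IsFractionRing.div_surjective (A := curveRing φ ψ) k
  obtain ⟨r, rfl⟩ := Ideal.Quotient.mk_surjective r
  obtain ⟨s, rfl⟩ := Ideal.Quotient.mk_surjective s
  exact div_mem (hp r) (hp s)

theorem curveRotation_curveEval {ζ : F} (hζ : IsPrimitiveRoot ζ 7) (p : MvPolynomial (Fin 2) F) :
    curveRotation hζ φ ψ (curveEval φ ψ p) = curveEval φ ψ (rotationPoly hζ p) := by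
  change IsFractionRing.fieldEquivOfAlgEquiv F (curveField φ ψ) (curveField φ ψ)
    (rotationRing hζ φ ψ) (algebraMap (curveRing φ ψ) (curveField φ ψ) (Ideal.Quotient.mk _ p)) = _
  rw [IsFractionRing.fieldEquivOfAlgEquiv_algebraMap]
  rfl

end PlaneCurve

/-! ### Fixed fields of diagonal automorphisms -/

/-- If `σ` fixes `M` and multiplies `x` by a primitive `n`-th root of unity, and `x ^ n ∈ M`, then
the elements of `M[x]` that are fixed by `σ` lie in `M`: average over the powers of `σ`. -/
theorem mem_of_apply_eq_self_of_mem_adjoin {F K : Type*} [Field F] [Field K] [Algebra F K]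
    (σ : K ≃ₐ[F] K) (M : IntermediateField F K) (hM : ∀ k ∈ M, σ k = k) {n : ℕ}
    (hn : (n : F) ≠ 0) {ζ : F} (hζ : IsPrimitiveRoot ζ n) {x : K}
    (hx : σ x = algebraMap F K ζ * x) (hxM : x ^ n ∈ M) {k : K} (hk : k ∈ Algebra.adjoin M {x})
    (hσk : σ k = k) : k ∈ M := by
  have hpow (j : ℕ) : (σ ^ j) x = algebraMap F K ζ ^ j * x := by
    induction j with
    | zero => simp
    | succ j ih =>
      rw [pow_succ', AlgEquiv.mul_apply, ih, map_mul, map_pow, AlgEquiv.commutes, hx]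
      ring
  have hfix {k : K} (h : σ k = k) (j : ℕ) : (σ ^ j) k = k := by
    induction j with
    | zero => simp
    | succ j ih => rw [pow_succ', AlgEquiv.mul_apply, ih, h]
  have hζK : IsPrimitiveRoot (algebraMap F K ζ) n := hζ.map_of_injective (algebraMap F K).injective
  have hsum : ∑ j ∈ Finset.range n, (σ ^ j) k ∈ M := by
    obtain ⟨P, rfl⟩ := Algebra.adjoin_mem_exists_aeval M x hk
    clear hk hσk
    induction P using Polynomial.induction_on' with
    | add P Q hP hQ =>
      simp only [map_add, Finset.sum_add_distrib]
      exact add_mem hP hQ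
    | monomial i c =>
      have hterm (j : ℕ) : (σ ^ j) (aeval x (monomial i c))
          = c * x ^ i * (algebraMap F K ζ ^ i) ^ j := by
        rw [aeval_monomial, map_mul, map_pow, hpow]
        have : (σ ^ j) (algebraMap M K c) = c := hfix (hM c c.2) j
        rw [this, mul_pow, ← pow_mul, ← pow_mul, mul_comm i j]
        ring
      simp only [hterm, ← Finset.mul_sum]
      by_cases hi : n ∣ i
      · obtain ⟨i, rfl⟩ := hi
        rw [pow_mul, pow_mul, hζK.pow_eq_one]
        simpa using mul_mem (mul_mem c.2 (pow_mem hxM i)) (natCast_mem M n)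
      · have h1 : algebraMap F K ζ ^ i ≠ 1 := fun h => hi (hζK.dvd_of_pow_eq_one i h)
        rw [geom_sum_eq h1, ← pow_mul, mul_comm i n, pow_mul, hζK.pow_eq_one]
        simp
  simp only [hfix hσk, Finset.sum_const, Finset.card_range, nsmul_eq_mul] at hsum
  have hnK : (n : K) ≠ 0 := by
    rw [← map_natCast (algebraMap F K)]
    exact (_root_.map_ne_zero _).2 hn
  simpa [hnK] using mul_mem (inv_mem (natCast_mem M n)) hsum

/-! ### The quotient curve as a hyperelliptic curve -/

section QuotientCurve

variable {F : Type*} [Field F]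

theorem four_mul_curvePoly {φ ψ c : F[X]} {a : F}
    (hdisc : ψ ^ 2 - 4 * (φ + 2 * X ^ 7) = (X - C a) * c ^ 2) :
    4 * curvePoly φ ψ =
      (2 * (MvPolynomial.X 0 ^ 7 - MvPolynomial.X 1 ^ 7)
        + aeval (MvPolynomial.X 0 * MvPolynomial.X 1 : MvPolynomial (Fin 2) F) ψ) ^ 2
      - (MvPolynomial.X 0 * MvPolynomial.X 1 - MvPolynomial.C a)
        * aeval (MvPolynomial.X 0 * MvPolynomial.X 1 : MvPolynomial (Fin 2) F) c ^ 2 := by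
  have h := congrArg (aeval (MvPolynomial.X 0 * MvPolynomial.X 1 : MvPolynomial (Fin 2) F)) hdisc
  simp only [map_sub, map_mul, map_pow, map_add, map_ofNat, aeval_X, aeval_C,
    MvPolynomial.algebraMap_eq] at h
  rw [curvePoly]
  linear_combination -h

theorem exists_sq_mul_squarefree {p : F[X]} (hp : p ≠ 0) :
    ∃ q s : F[X], Squarefree s ∧ p = q ^ 2 * s := by
  induction h : p.natDegree using Nat.strong_induction_on generalizing p with
  | _ d ih =>
    by_cases hs : Squarefree p
    · exact ⟨1, p, hs, by simp⟩
    · obtain ⟨g, ⟨r, hr⟩, hg⟩ : ∃ g, g * g ∣ p ∧ ¬ IsUnit g := by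
        simpa [Squarefree] using hs
      have hg0 : g ≠ 0 := by rintro rfl; simp_all
      have hr0 : r ≠ 0 := by rintro rfl; simp_all
      have hgd : 0 < g.natDegree := by
        rw [Nat.pos_iff_ne_zero]
        intro h0
        exact hg (isUnit_iff_degree_eq_zero.2 (by rw [degree_eq_natDegree hg0, h0]; rfl))
      have hd : p.natDegree = g.natDegree + g.natDegree + r.natDegree := by
        rw [hr, natDegree_mul (mul_ne_zero hg0 hg0) hr0, natDegree_mul hg0 hg0]
      obtain ⟨q, s, hs, rfl⟩ := ih r.natDegree (by omega) hr0 rfl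
      exact ⟨g * q, s, hs, by rw [hr]; ring⟩

theorem IntermediateField.aeval_mem {K : Type*} [Field K] [Algebra F K] (M : IntermediateField F K)
    {x : K} (hx : x ∈ M) (p : F[X]) : aeval x p ∈ M :=
  (Algebra.adjoin_le (S := M.toSubalgebra) (Set.singleton_subset_iff.2 hx))
    (aeval_mem_adjoin_singleton F x)

theorem IntermediateField.mem_fixedField_zpowers_iff {K : Type*} [Field K] [Algebra F K]
    (σ : K ≃ₐ[F] K) (k : K) :
    k ∈ IntermediateField.fixedField (Subgroup.zpowers σ) ↔ σ k = k := by
  rw [IntermediateField.mem_fixedField_iff]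
  refine ⟨fun h => h _ (Subgroup.mem_zpowers _), fun h g hg => ?_⟩
  have hle : Subgroup.zpowers σ ≤ MulAction.stabilizer _ k := Subgroup.zpowers_le.2 h
  exact hle hg

variable [CharZero F]

/-- If the discriminant of `f` as a quadratic polynomial in `x ^ 7 - y ^ 7` vanished, `f` would be a
square. -/
theorem disc_ne_zero {φ ψ c : F[X]} {a : F} (hf : Irreducible (curvePoly φ ψ))
    (hdisc : ψ ^ 2 - 4 * (φ + 2 * X ^ 7) = (X - C a) * c ^ 2) : c ≠ 0 := by
  rintro rfl
  have h := four_mul_curvePoly hdisc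
  have h2 : (2 : MvPolynomial (Fin 2) F) * MvPolynomial.C 2⁻¹ = 1 := by
    rw [← map_ofNat MvPolynomial.C 2, ← MvPolynomial.C_mul, mul_inv_cancel₀ two_ne_zero,
      MvPolynomial.C_1]
  refine hf.not_isSquare ⟨MvPolynomial.C 2⁻¹ * (2 * (MvPolynomial.X 0 ^ 7 - MvPolynomial.X 1 ^ 7)
        + aeval (MvPolynomial.X 0 * MvPolynomial.X 1 : MvPolynomial (Fin 2) F) ψ), ?_⟩
  rw [map_zero] at h
  linear_combination MvPolynomial.C 2⁻¹ ^ 2 * h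
    - curvePoly φ ψ * (2 * MvPolynomial.C 2⁻¹ + 1) * h2

/-- The leading coefficient is `2 - φ₇`: comparing coefficients of `w ^ 7` in the discriminant gives
`c₃ ^ 2 = -4 (φ₇ + 2)`, and `τ` has leading term `c₃ m ^ 7 / 2`. -/
theorem natDegree_tauPoly_sq_add {φ ψ c : F[X]} {a : F} (hψ : ψ.natDegree ≤ 3)
    (hc : c.natDegree ≤ 3) (hdisc : ψ ^ 2 - 4 * (φ + 2 * X ^ 7) = (X - C a) * c ^ 2)
    (hφ7 : φ.coeff 7 ≠ 2) : (tauPoly ψ c a ^ 2 + 4 * (X ^ 2 + C a) ^ 7).natDegree = 14 := by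
  have hlc : c.coeff 3 ^ 2 = -4 * (φ.coeff 7 + 2) := by
    have h := congrArg (fun p => p.coeff 7) hdisc
    have h1 : (ψ ^ 2).coeff 7 = 0 :=
      coeff_eq_zero_of_natDegree_lt (natDegree_pow_le.trans_lt (by omega))
    have h2 : ((X - C a) * c ^ 2).coeff (1 + 2 * 3) = (X - C a).coeff 1 * (c ^ 2).coeff (2 * 3) :=
      coeff_mul_add_eq_of_natDegree_le (natDegree_X_sub_C_le a)
        (natDegree_pow_le.trans (by omega))
    rw [coeff_pow_of_natDegree_le hc] at h2
    have h3 : (4 * (φ + 2 * X ^ 7)).coeff 7 = 4 * (φ.coeff 7 + 2) := by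
      rw [show (4 : F[X]) = C 4 from (map_ofNat C 4).symm,
        show (2 : F[X]) = C 2 from (map_ofNat C 2).symm]
      simp only [coeff_C_mul, coeff_add, coeff_X_pow]
      norm_num
    simp only [coeff_sub, h1, h3] at h
    rw [show 7 = 1 + 2 * 3 from rfl, h2] at h
    simp only [coeff_sub, coeff_X_one, coeff_C] at h
    norm_num at h
    linear_combination -h
  have hq : (X ^ 2 + C a).natDegree ≤ 2 := (natDegree_X_pow_add_C).le
  have hψ' : (ψ.comp (X ^ 2 + C a)).natDegree ≤ 6 :=
    natDegree_comp_le.trans ((Nat.mul_le_mul hψ hq).trans (by norm_num))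
  have hc' : (c.comp (X ^ 2 + C a)).natDegree ≤ 6 :=
    natDegree_comp_le.trans ((Nat.mul_le_mul hc hq).trans (by norm_num))
  have hc6 : (c.comp (X ^ 2 + C a)).coeff 6 = c.coeff 3 := by
    rcases hc.lt_or_eq with h | h
    · rw [coeff_eq_zero_of_natDegree_lt h, coeff_eq_zero_of_natDegree_lt]
      exact (natDegree_comp_le.trans (Nat.mul_le_mul_left _ hq)).trans_lt (by omega)
    · have h1 := coeff_comp_degree_mul_degree (p := c) (q := X ^ 2 + C a)
        (by rw [natDegree_X_pow_add_C]; norm_num)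
      rw [natDegree_X_pow_add_C, h] at h1
      rw [show 6 = 3 * 2 from rfl, h1, leadingCoeff, h,
        (monic_X_pow_add_C a two_ne_zero).leadingCoeff, one_pow, mul_one]
  have hτ : (tauPoly ψ c a).natDegree ≤ 7 := by
    refine (natDegree_C_mul_le _ _).trans (natDegree_add_le_of_degree_le ?_ ?_)
    · rw [natDegree_neg]; omega
    · exact natDegree_mul_le.trans (by rw [natDegree_X]; omega)
  have hτ7 : (tauPoly ψ c a).coeff 7 = 2⁻¹ * c.coeff 3 := by
    rw [tauPoly, coeff_C_mul, coeff_add, coeff_neg,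
      coeff_eq_zero_of_natDegree_lt (lt_of_le_of_lt hψ' (by norm_num)), coeff_X_mul, hc6, neg_zero,
      zero_add]
  have hq7 : ((X ^ 2 + C a) ^ 7).natDegree ≤ 14 :=
    natDegree_pow_le.trans ((Nat.mul_le_mul_left 7 hq).trans (by norm_num))
  have h4 : (4 : F[X]) = C 4 := (map_ofNat C 4).symm
  refine natDegree_eq_of_le_of_coeff_ne_zero (natDegree_add_le_of_degree_le
    (natDegree_pow_le.trans (by omega)) ?_) ?_
  · rw [h4]
    exact (natDegree_C_mul_le _ _).trans hq7
  · have h1 : (tauPoly ψ c a ^ 2).coeff (2 * 7) = _ := coeff_pow_of_natDegree_le hτ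
    have h2 : ((X ^ 2 + C a) ^ 7).coeff (7 * 2) = _ := coeff_pow_of_natDegree_le hq
    rw [h4, coeff_add, coeff_C_mul, show 14 = 2 * 7 from rfl, h1, show 2 * 7 = 7 * 2 from rfl, h2,
      hτ7]
    have h3 : (X ^ 2 + C a : F[X]).coeff 2 = 1 := by
      rw [coeff_add, coeff_X_pow, coeff_C]; norm_num
    rw [h3]
    intro h0
    apply hφ7
    linear_combination -h0 + hlc / 4

/-- If `x ^ 7 - y ^ 7` satisfies a quadratic equation over `F(x y)` of discriminant
`(x y - a) c(x y) ^ 2`, then the fixed field of `x ↦ ζ x`, `y ↦ ζ⁻¹ y` is generated by `m` and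
`z = x ^ 7 + y ^ 7`, where `x y = m ^ 2 + a`, `x ^ 7 - y ^ 7 = τ(m)`, and hence
`z ^ 2 = τ(m) ^ 2 + 4 (m ^ 2 + a) ^ 7`. -/
theorem exists_fixedField_generators {K : Type*} [Field K] [Algebra F K] {ζ : F}
    (hζ : IsPrimitiveRoot ζ 7) {ψ c : F[X]} {a : F} (hc0 : c ≠ 0) {x y : K}
    (hxt : Transcendental F x) (htop : IntermediateField.adjoin F {x, y} = ⊤)
    (hrel : 0 = (2 * (x ^ 7 - y ^ 7) + aeval (x * y) ψ) ^ 2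
      - (x * y - algebraMap F K a) * aeval (x * y) c ^ 2)
    (σ : K ≃ₐ[F] K) (hσx : σ x = algebraMap F K ζ * x) (hσy : σ y = algebraMap F K ζ⁻¹ * y) :
    ∃ m z : IntermediateField.fixedField (Subgroup.zpowers σ), Transcendental F m ∧
      z ^ 2 = aeval m (tauPoly ψ c a ^ 2 + 4 * (X ^ 2 + C a) ^ 7) ∧
      IntermediateField.adjoin F {m, z} = ⊤ := by
  have hx0 : x ≠ 0 := fun h => hxt (h ▸ isAlgebraic_zero)
  have two : (2 : K) ≠ 0 := by
    rw [← map_ofNat (algebraMap F K)]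
    exact (_root_.map_ne_zero _).2 two_ne_zero
  have hζ0 : ζ ≠ 0 := hζ.ne_zero (by norm_num)
  have hζK : algebraMap F K ζ * algebraMap F K ζ⁻¹ = 1 := by
    rw [← map_mul, mul_inv_cancel₀ hζ0, map_one]
  have hζ7 : algebraMap F K ζ ^ 7 = 1 := by
    rw [← map_pow, hζ.pow_eq_one, map_one]
  have hζ7' : algebraMap F K ζ⁻¹ ^ 7 = 1 := by
    rw [← map_pow, inv_pow, hζ.pow_eq_one, inv_one, map_one]
  -- If `w = x y` is algebraic over `F`, then so are `x ^ 7 - y ^ 7`, `x ^ 7 + y ^ 7` and `x`.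
  have hwt : Transcendental F (x * y) := by
    intro hw
    have hpoly (p : F[X]) : IsIntegral F (aeval (x * y) p) :=
      IsIntegral.of_mem_of_fg _ (hw.isIntegral.fg_adjoin_singleton) _
        (aeval_mem_adjoin_singleton F _)
    have h1 : IsIntegral F (2 * (x ^ 7 - y ^ 7) + aeval (x * y) ψ) := by
      refine IsIntegral.of_pow two_pos ?_
      have := hpoly ((X - C a) * c ^ 2)
      simp only [map_sub, map_mul, map_pow, aeval_X, aeval_C] at this
      rwa [sub_eq_zero.1 hrel.symm]
    have hhalf : IsIntegral F (algebraMap F K 2⁻¹) := isIntegral_algebraMap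
    have hh : algebraMap F K 2⁻¹ * 2 = 1 := by
      rw [map_inv₀, map_ofNat, inv_mul_cancel₀ two]
    have h2 : IsIntegral F (x ^ 7 - y ^ 7) := by
      have := hhalf.mul (h1.sub (hpoly ψ))
      rwa [add_sub_cancel_right, ← mul_assoc, hh, one_mul] at this
    have h3 : IsIntegral F (x ^ 7 + y ^ 7) := by
      refine IsIntegral.of_pow two_pos ?_
      have := (h2.pow 2).add (hpoly (4 * X ^ 7))
      simp only [map_mul, map_pow, aeval_X, map_ofNat] at this
      have h : (x ^ 7 + y ^ 7) ^ 2 = (x ^ 7 - y ^ 7) ^ 2 + 4 * (x * y) ^ 7 := by ring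
      rwa [h]
    have h4 : IsIntegral F (x ^ 7) := by
      have := hhalf.mul (h2.add h3)
      have h : x ^ 7 = algebraMap F K 2⁻¹ * (x ^ 7 - y ^ 7 + (x ^ 7 + y ^ 7)) := by
        linear_combination -x ^ 7 * hh
      rwa [h]
    exact hxt (h4.of_pow (by norm_num)).isAlgebraic
  have hcw : aeval (x * y) c ≠ 0 := fun h => hc0 (transcendental_iff.1 hwt c h)
  obtain ⟨m, hm⟩ : ∃ m, m * aeval (x * y) c = 2 * (x ^ 7 - y ^ 7) + aeval (x * y) ψ :=
    ⟨_, div_mul_cancel₀ _ hcw⟩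
  have hm2 : m ^ 2 + algebraMap F _ a = x * y := by
    apply mul_right_cancel₀ (pow_ne_zero 2 hcw)
    linear_combination (m * aeval (x * y) c + (2 * (x ^ 7 - y ^ 7) + aeval (x * y) ψ)) * hm - hrel
  have hma : aeval m (X ^ 2 + C a) = x * y := by simpa using hm2
  have hτ : aeval m (tauPoly ψ c a) = x ^ 7 - y ^ 7 := by
    simp only [tauPoly, map_mul, map_add, map_neg, aeval_comp, hma, aeval_X, aeval_C, hm, map_inv₀,
      map_ofNat]
    field_simp
    ring
  have hz : (x ^ 7 + y ^ 7) ^ 2 = aeval m (tauPoly ψ c a ^ 2 + 4 * (X ^ 2 + C a) ^ 7) := by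
    rw [map_add, map_mul, map_pow, map_pow, hτ, hma, map_ofNat]
    ring
  have hmt : Transcendental F m := fun h => hwt (by
    rw [← hm2]
    exact ((h.isIntegral.pow 2).add isIntegral_algebraMap).isAlgebraic)
  have hσw : σ (x * y) = x * y := by
    rw [map_mul, hσx, hσy]
    linear_combination x * y * hζK
  have hσx7 : σ (x ^ 7) = x ^ 7 := by rw [map_pow, hσx, mul_pow, hζ7, one_mul]
  have hσy7 : σ (y ^ 7) = y ^ 7 := by rw [map_pow, hσy, mul_pow, hζ7', one_mul]
  have hσm : σ m = m := by
    have h (p : F[X]) : σ (aeval (x * y) p) = aeval (x * y) p := by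
      rw [← Polynomial.aeval_algHom_apply, hσw]
    apply mul_right_cancel₀ hcw
    conv_lhs => rw [← h c, ← map_mul, hm]
    rw [map_add, map_mul, map_sub, hσx7, hσy7, h, map_ofNat, hm]
  have hσz : σ (x ^ 7 + y ^ 7) = x ^ 7 + y ^ 7 := by rw [map_add, hσx7, hσy7]
  let M := IntermediateField.adjoin F {m, x ^ 7 + y ^ 7}
  have hmM : m ∈ M := IntermediateField.subset_adjoin _ _ (by simp)
  have hzM : x ^ 7 + y ^ 7 ∈ M := IntermediateField.subset_adjoin _ _ (by simp)
  have hpM (p : F[X]) : aeval m p ∈ M := M.aeval_mem hmM p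
  have hMle : M ≤ IntermediateField.fixedField (Subgroup.zpowers σ) := by
    rw [IntermediateField.adjoin_le_iff]
    rintro k (rfl | rfl)
    · exact (IntermediateField.mem_fixedField_zpowers_iff σ _).2 hσm
    · exact (IntermediateField.mem_fixedField_zpowers_iff σ _).2 hσz
  have hxM : x ^ 7 ∈ M := by
    have h1 := div_mem (add_mem (hτ ▸ hpM _) hzM) (ofNat_mem M 2)
    convert h1 using 1
    field_simp
    ring
  have hxalg : IsAlgebraic M x := by
    have : IsIntegral M (x ^ 7) := isIntegral_algebraMap (x := (⟨x ^ 7, hxM⟩ : M))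
    exact (this.of_pow (by norm_num)).isAlgebraic
  have hMx : Algebra.adjoin M {x} = ⊤ := by
    rw [← IntermediateField.adjoin_simple_toSubalgebra_of_isAlgebraic hxalg,
      ← IntermediateField.top_toSubalgebra, IntermediateField.toSubalgebra_inj,
      ← IntermediateField.restrictScalars_eq_top_iff (K := F), eq_top_iff, ← htop,
      IntermediateField.adjoin_le_iff]
    have hx : x ∈ IntermediateField.adjoin M {x} := IntermediateField.mem_adjoin_simple_self M x
    rintro k (rfl | rfl)
    · exact hx
    · have hw : x * k ∈ IntermediateField.adjoin M {x} :=
        IntermediateField.algebraMap_mem (IntermediateField.adjoin M {x})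
          (⟨x * k, hma ▸ hpM _⟩ : M)
      simpa [hx0] using div_mem hw hx
  have hM : M = IntermediateField.fixedField (Subgroup.zpowers σ) := by
    refine le_antisymm hMle fun k hk => ?_
    exact mem_of_apply_eq_self_of_mem_adjoin σ M
      (fun k hk => (IntermediateField.mem_fixedField_zpowers_iff σ k).1 (hMle hk))
      (n := 7) (by norm_num) hζ hσx hxM (hMx ▸ Algebra.mem_top)
      ((IntermediateField.mem_fixedField_zpowers_iff σ k).1 hk)
  refine ⟨⟨m, hMle hmM⟩, ⟨x ^ 7 + y ^ 7, hMle hzM⟩, ?_, ?_, ?_⟩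
  · intro h
    exact hmt (h.algebraMap (A := K))
  · apply Subtype.ext
    refine hz.trans ?_
    exact Polynomial.aeval_algHom_apply (IntermediateField.fixedField (Subgroup.zpowers σ)).val
      ⟨m, hMle hmM⟩ _
  · apply IntermediateField.lift_injective
    rw [IntermediateField.lift_top, IntermediateField.lift_adjoin, Set.image_pair]
    exact hM

/-- The quotient curve is the hyperelliptic curve `z ^ 2 = τ(m) ^ 2 + 4 (m ^ 2 + a) ^ 7`. -/
theorem exists_quotientField_generators {ζ : F} (hζ : IsPrimitiveRoot ζ 7) {φ ψ c : F[X]} {a : F}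
    (hφ : φ.natDegree ≤ 7) (hψ : ψ.natDegree ≤ 3) [hf : Fact (Irreducible (curvePoly φ ψ))]
    (hdisc : ψ ^ 2 - 4 * (φ + 2 * X ^ 7) = (X - C a) * c ^ 2) :
    ∃ m z : quotientField hζ φ ψ, Transcendental F m ∧
      z ^ 2 = aeval m (tauPoly ψ c a ^ 2 + 4 * (X ^ 2 + C a) ^ 7) ∧
      IntermediateField.adjoin F {m, z} = ⊤ := by
  have hrel := congrArg (curveEval φ ψ) (four_mul_curvePoly hdisc)
  rw [map_mul, (curveEval_eq_zero_iff φ ψ _).2 dvd_rfl, mul_zero] at hrel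
  have hC (r : F) : curveEval φ ψ (MvPolynomial.C r) = algebraMap F _ r :=
    (curveEval φ ψ).commutes r
  simp only [map_sub, map_add, map_mul, map_pow, map_ofNat, ← Polynomial.aeval_algHom_apply,
    hC] at hrel
  refine exists_fixedField_generators hζ (disc_ne_zero hf.out hdisc)
    (transcendental_curveEval_X_zero φ ψ hφ hψ) (adjoin_curveEval_eq_top φ ψ) hrel
    (curveRotation hζ φ ψ) ?_ ?_
  · rw [curveRotation_curveEval, ← hC, ← map_mul]
    simp [rotationPoly, scaleHom]
  · rw [curveRotation_curveEval, ← hC, ← map_mul]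
    simp [rotationPoly, scaleHom]

end QuotientCurve

theorem propositionP {F : Type*} [Field F] [CharZero F]
    {ζ : F} (hζ : IsPrimitiveRoot ζ 7)
    (φ ψ c : Polynomial F) (a : F) (ha : a ≠ 0)
    (hφ : φ.natDegree ≤ 7) (hψ : ψ.natDegree ≤ 3) (hc : c.natDegree ≤ 3)
    [Fact (Irreducible (curvePoly φ ψ))]
    (hdisc : ψ ^ 2 - 4 * (φ + 2 * Polynomial.X ^ 7)
      = (Polynomial.X - Polynomial.C a) * c ^ 2)
    (hφ7 : φ.coeff 7 ≠ 2) :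
    functionFieldGenus F (quotientField hζ φ ψ) = 2 ↔
      ∃ q s : Polynomial F, q.natDegree = 4 ∧ s.natDegree = 6 ∧ Squarefree s ∧
        tauPoly ψ c a ^ 2 + 4 * (Polynomial.X ^ 2 + Polynomial.C a) ^ 7 = q ^ 2 * s := by
  have hdeg := natDegree_tauPoly_sq_add hψ hc hdisc hφ7
  obtain ⟨m, z, hm, hz, htop⟩ := exists_quotientField_generators hζ hφ hψ hdisc
  generalize tauPoly ψ c a ^ 2 + 4 * (Polynomial.X ^ 2 + Polynomial.C a) ^ 7 = D at *
  have hD : D ≠ 0 := by rintro rfl; simp at hdeg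
  -- Over `F(m)` the function field is also generated by `z / q(m)`, a root of the squarefree part.
  have key {q s : F[X]} (hs : Squarefree s) (hqs : D = q ^ 2 * s) :
      q.natDegree ≤ 7 ∧ s.natDegree = 2 * (7 - q.natDegree) ∧
        functionFieldGenus F (quotientField hζ φ ψ) = 7 - q.natDegree - 1 := by
    have hq : q ≠ 0 := by rintro rfl; simp_all
    have hd := hdeg
    rw [hqs, natDegree_mul (pow_ne_zero 2 hq) hs.ne_zero, natDegree_pow] at hd
    have hqm : aeval m q ≠ 0 := fun h => hq (transcendental_iff.1 hm q h)
    refine ⟨by omega, by omega,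
      functionFieldGenus_of_sq_eq (z := z / aeval m q) hm hs ?_ ?_ (by omega)⟩
    · rw [div_pow, hz, hqs, map_mul, map_pow, mul_div_cancel_left₀ _ (pow_ne_zero 2 hqm)]
    · have hmem : m ∈ IntermediateField.adjoin F {m, z / aeval m q} :=
        IntermediateField.subset_adjoin _ _ (by simp)
      have hqmem : aeval m q ∈ IntermediateField.adjoin F {m, z / aeval m q} :=
        IntermediateField.aeval_mem _ hmem q
      rw [eq_top_iff, ← htop, IntermediateField.adjoin_le_iff]
      rintro k (rfl | rfl)
      · exact hmem
      · have h := mul_mem (IntermediateField.subset_adjoin F {m, k / aeval m q}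
          (Set.mem_insert_of_mem _ rfl)) hqmem
        rwa [div_mul_cancel₀ _ hqm] at h
  constructor
  · intro hg
    obtain ⟨q, s, hs, hqs⟩ := exists_sq_mul_squarefree hD
    obtain ⟨h1, h2, h3⟩ := key hs hqs
    exact ⟨q, s, by omega, by omega, hs, hqs⟩
  · rintro ⟨q, s, hq, -, hs, hqs⟩
    rw [(key hs hqs).2.2, hq]
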